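/- All spaces are complex Banach spaces. $\mathcal F(E,F)$ is the space of bounded finite-rank operators $E\to F$, $\mathcal F(E)=\mathcal F(E,E)$, and $\mathcal A(X)$ is the closure of $\mathcal F(X)$ in the operator norm. An *operator ideal norm* on $\mathcal F$ is a function $\gamma$ assigning to every finite-rank operator between Banach spaces a number in $[0,\infty)$ such that (a) $\gamma$ is a norm on each $\mathcal F(E,F)$, (b) $\gamma(I_{\mathbb C})=1$, and (c) $\gamma(ATB)\le\|A\|\,\gamma(T)\,\|B\|$ for $T\in\mathcal F(E,F)$ and bounded $A:F\to F_0$, $B:E_0\to E$. A Banach algebra $\mathcal A$ is *$K$-amenable* if there is a net $(d_\alpha)$ in the projective tensor product $\mathcal A\widehat\otimes\mathcal A$ with $\|d_\alpha\|\le K$ for all $\alpha$ such that $\pi(d_\alpha)a\to a$ and $a\cdot d_\alpha-d_\alpha\cdot a\to0$ for all $a\in\mathcal A$, where $\pi(a\otimes b)=ab$, $a\cdot(b\otimes c)=ab\otimes c$ and $(b\otimes c)\cdot a=b\otimes ca$. Let $X$ be a Banach space such that $\mathcal A(X)$ is $K$-amenable, let $P:X\to X$ be a bounded projection with $P\ne0$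 and $P\ne I$, and set $Y=\operatorname{rg}P$, $Z=\operatorname{rg}(I-P)$. Then there is a number $$0<\kappa\le 4K^2\,\|P\|\,\|I-P\|\,\max\{\|P\|^4,\|I-P\|^4\}$$ such that for all operator ideal norms $\gamma,\tau$ on $\mathcal F$ and all constants $c,C>0$: if $c\gamma\le\tau\le C\gamma$ on $\mathcal F(Y,Z)$ or on $\mathcal F(Z,Y)$, then $$c\,\kappa^{-2}\gamma\le\tau\le C\,\kappa^{2}\gamma$$ on $\mathcal F(Y)$ or on $\mathcal F(Z)$. -/

import Mathlib

open scoped TensorProduct Topology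

universe u

noncomputable section

namespace OperatorIdeals

/-! ### Finite-rank and approximable operators -/

section Operators

/-- `𝓕(E, F)`: the space of bounded finite-rank operators from `E` to `F`. -/
def finiteRank (E F : Type u) [NormedAddCommGroup E] [NormedSpace ℂ E]
    [NormedAddCommGroup F] [NormedSpace ℂ F] : Submodule ℂ (E →L[ℂ] F) where
  carrier := {T | FiniteDimensional ℂ (LinearMap.range (T : E →ₗ[ℂ] F))}
  zero_mem' := by
    have h : LinearMap.range ((0 : E →L[ℂ] F) : E →ₗ[ℂ] F) = ⊥ := by
      simp
    change FiniteDimensional ℂ (LinearMap.range ((0 : E →L[ℂ] F) : E →ₗ[ℂ] F))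
    rw [h]
    infer_instance
  add_mem' := by
    intro S T hS hT
    have hS' : FiniteDimensional ℂ (LinearMap.range (S : E →ₗ[ℂ] F)) := hS
    have hT' : FiniteDimensional ℂ (LinearMap.range (T : E →ₗ[ℂ] F)) := hT
    refine Submodule.finiteDimensional_of_le
      (S₂ := LinearMap.range (S : E →ₗ[ℂ] F) ⊔ LinearMap.range (T : E →ₗ[ℂ] F)) ?_
    rintro _ ⟨x, rfl⟩
    exact Submodule.add_mem_sup ⟨x, rfl⟩ ⟨x, rfl⟩
  smul_mem' := by
    intro a T hT
    have hT' : FiniteDimensional ℂ (LinearMap.range (T : E →ₗ[ℂ] F)) := hT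
    refine Submodule.finiteDimensional_of_le (S₂ := LinearMap.range (T : E →ₗ[ℂ] F)) ?_
    rintro _ ⟨x, rfl⟩
    exact ⟨a • x, by simp⟩

theorem mem_finiteRank {E F : Type u} [NormedAddCommGroup E] [NormedSpace ℂ E]
    [NormedAddCommGroup F] [NormedSpace ℂ F] {T : E →L[ℂ] F} :
    T ∈ finiteRank E F ↔ FiniteDimensional ℂ (LinearMap.range (T : E →ₗ[ℂ] F)) :=
  Iff.rfl

/-- `A ∘ T ∘ B` has finite rank whenever `T` has. -/
theorem comp_comp_mem_finiteRank {E₀ E F F₀ : Type u}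
    [NormedAddCommGroup E₀] [NormedSpace ℂ E₀] [NormedAddCommGroup E] [NormedSpace ℂ E]
    [NormedAddCommGroup F] [NormedSpace ℂ F] [NormedAddCommGroup F₀] [NormedSpace ℂ F₀]
    (A : F →L[ℂ] F₀) {T : E →L[ℂ] F} (hT : T ∈ finiteRank E F) (B : E₀ →L[ℂ] E) :
    (A.comp T).comp B ∈ finiteRank E₀ F₀ := by
  have hT' : FiniteDimensional ℂ (LinearMap.range (T : E →ₗ[ℂ] F)) := hT
  rw [mem_finiteRank]
  refine Submodule.finiteDimensional_of_le
    (S₂ := (LinearMap.range (T : E →ₗ[ℂ] F)).map (A : F →ₗ[ℂ] F₀)) ?_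
  rintro _ ⟨x, rfl⟩
  exact ⟨T (B x), ⟨B x, rfl⟩, rfl⟩

/-- `A T B` as an element of `𝓕(E₀, F₀)`, for `T ∈ 𝓕(E, F)`. -/
def finiteRank.sandwich {E₀ E F F₀ : Type u}
    [NormedAddCommGroup E₀] [NormedSpace ℂ E₀] [NormedAddCommGroup E] [NormedSpace ℂ E]
    [NormedAddCommGroup F] [NormedSpace ℂ F] [NormedAddCommGroup F₀] [NormedSpace ℂ F₀]
    (A : F →L[ℂ] F₀) (T : finiteRank E F) (B : E₀ →L[ℂ] E) : finiteRank E₀ F₀ :=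
  ⟨(A.comp (T : E →L[ℂ] F)).comp B, comp_comp_mem_finiteRank A T.2 B⟩

/-- The identity of the one-dimensional space `ℂ` (lifted to the ambient universe). -/
def finiteRank.idScalar : finiteRank (ULift.{u} ℂ) (ULift.{u} ℂ) :=
  ⟨ContinuousLinearMap.id ℂ (ULift.{u} ℂ), by
    rw [mem_finiteRank]
    have : FiniteDimensional ℂ (ULift.{u} ℂ) := inferInstance
    infer_instance⟩

/-- The algebra `𝓕(X)` of finite-rank operators on `X`. -/
def finiteRankAlgebra (X : Type u) [NormedAddCommGroup X] [NormedSpace ℂ X] :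
    NonUnitalSubalgebra ℂ (X →L[ℂ] X) :=
  { finiteRank X X with
    mul_mem' := by
      intro S T hS hT
      exact comp_comp_mem_finiteRank (ContinuousLinearMap.id ℂ X) hS T }

/-- `𝓐(X)`: the algebra of approximable operators on `X`, that is, the closure of the
finite-rank operators in the operator norm. -/
def approximable (X : Type u) [NormedAddCommGroup X] [NormedSpace ℂ X] :
    NonUnitalSubalgebra ℂ (X →L[ℂ] X) :=
  (finiteRankAlgebra X).topologicalClosure

/-- `rg T`: the range of a bounded operator `T`. -/
abbrev rg {X : Type u} [NormedAddCommGroup X] [NormedSpace ℂ X] (T : X →L[ℂ] X) :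
    Submodule ℂ X :=
  LinearMap.range (T : X →ₗ[ℂ] X)

/-- The range of a bounded projection on a Banach space is a Banach space. -/
theorem completeSpace_range {X : Type u} [NormedAddCommGroup X] [NormedSpace ℂ X]
    [CompleteSpace X] {P : X →L[ℂ] X} (hP : IsIdempotentElem P) :
    CompleteSpace (rg P) := by
  have h : (rg P : Set X) = {x | P x = x} := by
    ext x
    constructor
    · rintro ⟨y, rfl⟩
      exact DFunLike.congr_fun hP.eq y
    · intro hx
      exact ⟨x, hx⟩
  have hc : IsClosed (rg P : Set X) := by
    rw [h]
    exact isClosed_eq P.continuous continuous_id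
  exact hc.completeSpace_coe

end Operators

/-! ### Operator ideal norms -/

/-- An operator ideal norm on the ideal `𝓕` of finite-rank operators between complex Banach
spaces. -/
structure OperatorIdealNorm where
  /-- The value of the norm at a finite-rank operator. -/
  toFun : ∀ {E F : Type u} [NormedAddCommGroup E] [NormedSpace ℂ E] [CompleteSpace E]
    [NormedAddCommGroup F] [NormedSpace ℂ F] [CompleteSpace F], finiteRank E F → ℝ
  nonneg : ∀ {E F : Type u} [NormedAddCommGroup E] [NormedSpace ℂ E] [CompleteSpace E]
    [NormedAddCommGroup F] [NormedSpace ℂ F] [CompleteSpace F] (T : finiteRank E F),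
    0 ≤ toFun T
  eq_zero_of_eq_zero : ∀ {E F : Type u} [NormedAddCommGroup E] [NormedSpace ℂ E]
    [CompleteSpace E] [NormedAddCommGroup F] [NormedSpace ℂ F] [CompleteSpace F]
    (T : finiteRank E F), toFun T = 0 → T = 0
  add_le : ∀ {E F : Type u} [NormedAddCommGroup E] [NormedSpace ℂ E] [CompleteSpace E]
    [NormedAddCommGroup F] [NormedSpace ℂ F] [CompleteSpace F] (S T : finiteRank E F),
    toFun (S + T) ≤ toFun S + toFun T
  map_smul : ∀ {E F : Type u} [NormedAddCommGroup E] [NormedSpace ℂ E] [CompleteSpace E]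
    [NormedAddCommGroup F] [NormedSpace ℂ F] [CompleteSpace F] (a : ℂ) (T : finiteRank E F),
    toFun (a • T) = ‖a‖ * toFun T
  map_idScalar : toFun finiteRank.idScalar = 1
  ideal : ∀ {E₀ E F F₀ : Type u} [NormedAddCommGroup E₀] [NormedSpace ℂ E₀] [CompleteSpace E₀]
    [NormedAddCommGroup E] [NormedSpace ℂ E] [CompleteSpace E]
    [NormedAddCommGroup F] [NormedSpace ℂ F] [CompleteSpace F]
    [NormedAddCommGroup F₀] [NormedSpace ℂ F₀] [CompleteSpace F₀]
    (A : F →L[ℂ] F₀) (T : finiteRank E F) (B : E₀ →L[ℂ] E),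
    toFun (finiteRank.sandwich A T B) ≤ ‖A‖ * toFun T * ‖B‖

/-- `c γ ≤ τ ≤ C γ` on `𝓕(E, F)`. -/
def NormBounds (γ τ : OperatorIdealNorm.{u}) (c C : ℝ) (E F : Type u)
    [NormedAddCommGroup E] [NormedSpace ℂ E] [CompleteSpace E]
    [NormedAddCommGroup F] [NormedSpace ℂ F] [CompleteSpace F] : Prop :=
  ∀ T : finiteRank E F, c * γ.toFun T ≤ τ.toFun T ∧ τ.toFun T ≤ C * γ.toFun T

/-! ### The projective tensor product -/

section Projective

variable {E F : Type u} [NormedAddCommGroup E] [NormedSpace ℂ E]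
  [NormedAddCommGroup F] [NormedSpace ℂ F]

/-- The tensor `∑ xᵢ ⊗ yᵢ` given by a finite list of pairs `(xᵢ, yᵢ)`. -/
def repSum (l : List (E × F)) : E ⊗[ℂ] F := (l.map fun p => p.1 ⊗ₜ[ℂ] p.2).sum

/-- The number `∑ ‖xᵢ‖ ‖yᵢ‖` given by a finite list of pairs `(xᵢ, yᵢ)`. -/
def repCost (l : List (E × F)) : ℝ := (l.map fun p => ‖p.1‖ * ‖p.2‖).sum

/-- The projective norm on the algebraic tensor product: the infimum of `∑ ‖xᵢ‖ ‖yᵢ‖` over all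
representations `∑ xᵢ ⊗ yᵢ` of the tensor. -/
def projNorm (x : E ⊗[ℂ] F) : ℝ := sInf (repCost '' {l : List (E × F) | repSum l = x})

theorem repCost_nonneg (l : List (E × F)) : 0 ≤ repCost l := by
  unfold repCost
  refine List.sum_nonneg ?_
  intro r hr
  obtain ⟨p, -, rfl⟩ := List.mem_map.1 hr
  positivity

theorem repSum_append (l m : List (E × F)) : repSum (l ++ m) = repSum l + repSum m := by
  simp [repSum]

theorem repCost_append (l m : List (E × F)) : repCost (l ++ m) = repCost l + repCost m := by
  simp [repCost]

theorem exists_repSum (x : E ⊗[ℂ] F) : ∃ l : List (E × F), repSum l = x := by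
  induction x using TensorProduct.induction_on with
  | zero => exact ⟨[], by simp [repSum]⟩
  | tmul a b => exact ⟨[(a, b)], by simp [repSum]⟩
  | add x y hx hy =>
    obtain ⟨l, rfl⟩ := hx
    obtain ⟨m, rfl⟩ := hy
    exact ⟨l ++ m, repSum_append l m⟩

theorem projNorm_le (l : List (E × F)) : projNorm (repSum l) ≤ repCost l := by
  refine csInf_le ⟨0, ?_⟩ ⟨l, rfl, rfl⟩
  rintro _ ⟨m, -, rfl⟩
  exact repCost_nonneg m

theorem le_projNorm {x : E ⊗[ℂ] F} {r : ℝ}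
    (h : ∀ l : List (E × F), repSum l = x → r ≤ repCost l) : r ≤ projNorm x := by
  obtain ⟨l, hl⟩ := exists_repSum x
  refine le_csInf ⟨_, l, hl, rfl⟩ ?_
  rintro _ ⟨m, hm, rfl⟩
  exact h m hm

theorem projNorm_nonneg (x : E ⊗[ℂ] F) : 0 ≤ projNorm x :=
  le_projNorm fun l _ => repCost_nonneg l

theorem projNorm_zero : projNorm (0 : E ⊗[ℂ] F) = 0 := by
  refine le_antisymm ?_ (projNorm_nonneg _)
  simpa [repSum, repCost] using projNorm_le ([] : List (E × F))

theorem projNorm_add_le (x y : E ⊗[ℂ] F) : projNorm (x + y) ≤ projNorm x + projNorm y := by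
  have h1 : projNorm (x + y) - projNorm y ≤ projNorm x := by
    refine le_projNorm fun l hl => ?_
    have h2 : projNorm (x + y) - repCost l ≤ projNorm y := by
      refine le_projNorm fun m hm => ?_
      have h3 := projNorm_le (l ++ m)
      rw [repSum_append, repCost_append, hl, hm] at h3
      linarith
    linarith
  linarith

/-- A subadditive functional on `E ⊗ F` is bounded by the projective norm as soon as it is so on
elementary tensors. -/
theorem le_mul_projNorm {N : E ⊗[ℂ] F → ℝ} (hN0 : N 0 ≤ 0)
    (hN : ∀ x y, N (x + y) ≤ N x + N y) {C : ℝ} (hC : 0 ≤ C)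
    (h : ∀ a b, N (a ⊗ₜ[ℂ] b) ≤ C * (‖a‖ * ‖b‖)) (x : E ⊗[ℂ] F) : N x ≤ C * projNorm x := by
  have key : ∀ l : List (E × F), N (repSum l) ≤ C * repCost l := by
    intro l
    induction l with
    | nil => simpa [repSum, repCost] using hN0
    | cons p l ih =>
      have h1 := hN (p.1 ⊗ₜ[ℂ] p.2) (repSum l)
      have h2 := h p.1 p.2
      have h3 : repSum (p :: l) = p.1 ⊗ₜ[ℂ] p.2 + repSum l := by simp [repSum]
      have h4 : repCost (p :: l) = ‖p.1‖ * ‖p.2‖ + repCost l := by simp [repCost]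
      rw [h3, h4, mul_add]
      linarith
  rcases hC.eq_or_lt with rfl | hC'
  · obtain ⟨l, rfl⟩ := exists_repSum x
    simpa using key l
  · have : N x / C ≤ projNorm x := by
      refine le_projNorm fun l hl => ?_
      rw [div_le_iff₀' hC', ← hl]
      exact key l
    rwa [div_le_iff₀' hC'] at this

theorem projNorm_smul_le (a : ℂ) (x : E ⊗[ℂ] F) : projNorm (a • x) ≤ ‖a‖ * projNorm x := by
  refine le_mul_projNorm (N := fun x => projNorm (a • x)) ?_ ?_ (norm_nonneg a) ?_ x
  · simp [projNorm_zero]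
  · intro x y
    rw [smul_add]
    exact projNorm_add_le _ _
  · intro b c
    have h := projNorm_le [(a • b, c)]
    simp only [repSum, repCost, List.map_cons, List.map_nil, List.sum_cons, List.sum_nil,
      add_zero] at h
    rwa [norm_smul, mul_assoc, ← TensorProduct.smul_tmul'] at h

/-- The projective norm as a seminorm. -/
def projSeminorm (E F : Type u) [NormedAddCommGroup E] [NormedSpace ℂ E]
    [NormedAddCommGroup F] [NormedSpace ℂ F] : Seminorm ℂ (E ⊗[ℂ] F) :=
  Seminorm.ofSMulLE projNorm projNorm_zero projNorm_add_le projNorm_smul_le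

/-- The algebraic tensor product `E ⊗ F`, to be given the projective norm. -/
def AlgTensor (E F : Type u) [NormedAddCommGroup E] [NormedSpace ℂ E]
    [NormedAddCommGroup F] [NormedSpace ℂ F] : Type u := E ⊗[ℂ] F

instance : AddCommGroup (AlgTensor E F) := inferInstanceAs (AddCommGroup (E ⊗[ℂ] F))

instance : Module ℂ (AlgTensor E F) := inferInstanceAs (Module ℂ (E ⊗[ℂ] F))

/-- The identity map from `E ⊗ F` to its copy carrying the projective norm. -/
def AlgTensor.of (E F : Type u) [NormedAddCommGroup E] [NormedSpace ℂ E]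
    [NormedAddCommGroup F] [NormedSpace ℂ F] : E ⊗[ℂ] F ≃ₗ[ℂ] AlgTensor E F :=
  LinearEquiv.refl ℂ (E ⊗[ℂ] F)

instance : SeminormedAddCommGroup (AlgTensor E F) :=
  fast_instance% AddGroupSeminorm.toSeminormedAddCommGroup
    ((projSeminorm E F).comp (AlgTensor.of E F).symm.toLinearMap).toAddGroupSeminorm

theorem AlgTensor.norm_of (x : E ⊗[ℂ] F) : ‖AlgTensor.of E F x‖ = projNorm x := rfl

theorem AlgTensor.norm_def (x : AlgTensor E F) :
    ‖x‖ = projNorm ((AlgTensor.of E F).symm x) := rfl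

instance : NormedSpace ℂ (AlgTensor E F) where
  norm_smul_le a x := by
    rw [AlgTensor.norm_def, AlgTensor.norm_def, map_smul]
    exact projNorm_smul_le a _

/-- The projective tensor product `E ⊗̂ F`: the completion of `E ⊗ F` for the projective norm. -/
abbrev ProjTensor (E F : Type u) [NormedAddCommGroup E] [NormedSpace ℂ E]
    [NormedAddCommGroup F] [NormedSpace ℂ F] : Type u :=
  UniformSpace.Completion (AlgTensor E F)

end Projective

/-! ### Amenable Banach algebras -/

section Amenable

variable {A : Type u} [NonUnitalNormedRing A] [NormedSpace ℂ A] [IsScalarTower ℂ A A]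
  [SMulCommClass ℂ A A]

theorem norm_mul'_le (x : AlgTensor A A) :
    ‖(LinearMap.mul' ℂ A ∘ₗ (AlgTensor.of A A).symm.toLinearMap) x‖ ≤ 1 * ‖x‖ := by
  rw [AlgTensor.norm_def, LinearMap.comp_apply, LinearEquiv.coe_coe]
  refine le_mul_projNorm (N := fun x : A ⊗[ℂ] A => ‖LinearMap.mul' ℂ A x‖) ?_ ?_
    zero_le_one ?_ ((AlgTensor.of A A).symm x)
  · simp
  · intro x y
    simpa using norm_add_le (LinearMap.mul' ℂ A x) (LinearMap.mul' ℂ A y)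
  · intro a b
    simpa using norm_mul_le a b

theorem norm_map_le (f g : A →ₗ[ℂ] A) {C : ℝ} (hC : 0 ≤ C)
    (h : ∀ b c, ‖f b‖ * ‖g c‖ ≤ C * (‖b‖ * ‖c‖)) (x : AlgTensor A A) :
    ‖((AlgTensor.of A A).toLinearMap ∘ₗ TensorProduct.map f g ∘ₗ
      (AlgTensor.of A A).symm.toLinearMap) x‖ ≤ C * ‖x‖ := by
  rw [AlgTensor.norm_def x, LinearMap.comp_apply, LinearMap.comp_apply, LinearEquiv.coe_coe,
    LinearEquiv.coe_coe, AlgTensor.norm_of]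
  refine le_mul_projNorm (N := fun x : A ⊗[ℂ] A => projNorm (TensorProduct.map f g x)) ?_ ?_
    hC ?_ ((AlgTensor.of A A).symm x)
  · simp [projNorm_zero]
  · intro x y
    rw [map_add]
    exact projNorm_add_le _ _
  · intro b c
    have h' := projNorm_le [(f b, g c)]
    simp only [repSum, repCost, List.map_cons, List.map_nil, List.sum_cons, List.sum_nil,
      add_zero] at h'
    exact h'.trans (h b c)

/-- The product map `A ⊗ A → A`, `a ⊗ b ↦ a b`, on the algebraic tensor product. -/
def algProduct (A : Type u) [NonUnitalNormedRing A] [NormedSpace ℂ A] [IsScalarTower ℂ A A]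
    [SMulCommClass ℂ A A] : AlgTensor A A →L[ℂ] A :=
  LinearMap.mkContinuous (LinearMap.mul' ℂ A ∘ₗ (AlgTensor.of A A).symm.toLinearMap) 1
    norm_mul'_le

/-- The map `b ⊗ c ↦ a b ⊗ c` on the algebraic tensor product. -/
def algLeft (a : A) : AlgTensor A A →L[ℂ] AlgTensor A A :=
  LinearMap.mkContinuous ((AlgTensor.of A A).toLinearMap ∘ₗ
    TensorProduct.map (LinearMap.mulLeft ℂ a) LinearMap.id ∘ₗ
    (AlgTensor.of A A).symm.toLinearMap) ‖a‖ <|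
  norm_map_le _ _ (norm_nonneg a) fun b c => by
    rw [LinearMap.mulLeft_apply, LinearMap.id_apply, ← mul_assoc]
    gcongr
    exact norm_mul_le a b

/-- The map `b ⊗ c ↦ b ⊗ c a` on the algebraic tensor product. -/
def algRight (a : A) : AlgTensor A A →L[ℂ] AlgTensor A A :=
  LinearMap.mkContinuous ((AlgTensor.of A A).toLinearMap ∘ₗ
    TensorProduct.map LinearMap.id (LinearMap.mulRight ℂ a) ∘ₗ
    (AlgTensor.of A A).symm.toLinearMap) ‖a‖ <|
  norm_map_le _ _ (norm_nonneg a) fun b c => by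
    rw [LinearMap.mulRight_apply, LinearMap.id_apply, mul_left_comm, mul_comm ‖a‖]
    gcongr
    exact norm_mul_le c a

theorem algProduct_tmul (a b : A) : algProduct A (AlgTensor.of A A (a ⊗ₜ[ℂ] b)) = a * b := by
  simp [algProduct]

theorem algLeft_tmul (a b c : A) : algLeft a (AlgTensor.of A A (b ⊗ₜ[ℂ] c)) =
    AlgTensor.of A A ((a * b) ⊗ₜ[ℂ] c) := by
  simp [algLeft]

theorem algRight_tmul (a b c : A) : algRight a (AlgTensor.of A A (b ⊗ₜ[ℂ] c)) =
    AlgTensor.of A A (b ⊗ₜ[ℂ] (c * a)) := by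
  simp [algRight]

/-- The continuous product map `π : A ⊗̂ A → A`, `a ⊗ b ↦ a b`. -/
def productMap (A : Type u) [NonUnitalNormedRing A] [NormedSpace ℂ A] [IsScalarTower ℂ A A]
    [SMulCommClass ℂ A A] [CompleteSpace A] : ProjTensor A A → A :=
  UniformSpace.Completion.extension (algProduct A)

/-- The left action of `A` on `A ⊗̂ A`, `a · (b ⊗ c) = a b ⊗ c`. -/
def leftAct (a : A) : ProjTensor A A → ProjTensor A A :=
  UniformSpace.Completion.map (algLeft a)

/-- The right action of `A` on `A ⊗̂ A`, `(b ⊗ c) · a = b ⊗ c a`. -/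
def rightAct (d : ProjTensor A A) (a : A) : ProjTensor A A :=
  UniformSpace.Completion.map (algRight a) d

/-- The product map on `A ⊗̂ A` extends the one on the algebraic tensor product. -/
theorem productMap_coe [CompleteSpace A] (x : AlgTensor A A) :
    productMap A (x : ProjTensor A A) = algProduct A x :=
  UniformSpace.Completion.extension_coe (algProduct A).uniformContinuous x

theorem leftAct_coe (a : A) (x : AlgTensor A A) :
    leftAct a (x : ProjTensor A A) = (algLeft a x : AlgTensor A A) :=
  UniformSpace.Completion.map_coe (algLeft a).uniformContinuous x

theorem rightAct_coe (a : A) (x : AlgTensor A A) :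
    rightAct (x : ProjTensor A A) a = (algRight a x : AlgTensor A A) :=
  UniformSpace.Completion.map_coe (algRight a).uniformContinuous x

/-- A Banach algebra `A` is `K`-amenable if it has an approximate diagonal of bound `K`: a net
`(d_i)` in `A ⊗̂ A` with `‖d_i‖ ≤ K` for all `i` such that, for all `a ∈ A`, `π(d_i) a → a` and
`a · d_i - d_i · a → 0`. -/
def IsKAmenable (A : Type u) [NonUnitalNormedRing A] [NormedSpace ℂ A] [IsScalarTower ℂ A A]
    [SMulCommClass ℂ A A] [CompleteSpace A] (K : ℝ) : Prop :=
  ∃ (ι : Type u) (_ : Preorder ι) (_ : IsDirectedOrder ι) (_ : Nonempty ι)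
    (d : ι → ProjTensor A A),
    (∀ i, ‖d i‖ ≤ K) ∧
    (∀ a : A, Filter.Tendsto (fun i => productMap A (d i) * a) Filter.atTop (𝓝 a)) ∧
    (∀ a : A, Filter.Tendsto (fun i => leftAct a (d i) - rightAct (d i) a) Filter.atTop (𝓝 0))

end Amenable

instance (X : Type u) [NormedAddCommGroup X] [NormedSpace ℂ X] :
    NormedSpace ℂ (approximable X) where
  norm_smul_le a T := norm_smul_le a (T : X →L[ℂ] X)

instance (X : Type u) [NormedAddCommGroup X] [NormedSpace ℂ X] [CompleteSpace X] :
    CompleteSpace (approximable X) :=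
  (NonUnitalSubalgebra.isClosed_topologicalClosure (finiteRankAlgebra X)).completeSpace_coe

end OperatorIdeals

end

/-!
If `∑ aₖ ⊗ bₖ` runs through an approximate diagonal of `𝓐(X)` and `s` is any bounded operator on
`X`, then the operators `∑ aₖ s bₖ` asymptotically commute with `𝓐(X)`. By compactness and
irreducibility they act on the finite-rank operators, in the limit along a subnet, as a scalar
`c(s)`, where `c` is additive and `c(1) = 1`. Hence `c(P) + c(1 - P) = 1`, and one of the two
scalars has modulus at least `1 / 2`, say `c(1 - P)`. Compressing to `Y = rg P` then approximates a
multiple of the identity of `Y` by the operators `∑ (P aₖ|Z) ∘ ((1 - P) bₖ|Y)`, each of which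
factors through `Z = rg (1 - P)`, so the values of an ideal norm on `𝓕(Y)` are controlled by those
on `𝓕(Y, Z)`, and by those on `𝓕(Z, Y)`.
-/

universe v

noncomputable section

namespace OperatorIdeals

/-! ### The universal property of the projective tensor product -/

namespace ProjTensor

variable {E F : Type u} {G : Type*} [NormedAddCommGroup E] [NormedSpace ℂ E]
  [NormedAddCommGroup F] [NormedSpace ℂ F] [NormedAddCommGroup G] [NormedSpace ℂ G]

/-- The elementary tensor `a ⊗ b` in `E ⊗̂ F`. -/
def tmul (a : E) (b : F) : ProjTensor E F := (AlgTensor.of E F (a ⊗ₜ[ℂ] b) : AlgTensor E F)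

theorem induction_on {p : ProjTensor E F → Prop} (d : ProjTensor E F) (closed : IsClosed {d | p d})
    (tmul : ∀ a b, p (tmul a b))
    (add : ∀ x y : AlgTensor E F, p x → p y → p (x + y : AlgTensor E F)) : p d := by
  have algebraic (x : E ⊗[ℂ] F) : p (AlgTensor.of E F x : AlgTensor E F) := by
    induction x using TensorProduct.induction_on with
    | zero => simpa [ProjTensor.tmul] using tmul 0 0
    | tmul a b => exact tmul a b
    | add x y hx hy => simpa only [map_add] using add _ _ hx hy
  exact UniformSpace.Completion.induction_on d closed algebraic

theorem seminorm_le_mul_norm {p : Seminorm ℂ (ProjTensor E F)} (hp : Continuous p) {C : ℝ}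
    (hC : 0 ≤ C) (h : ∀ a b, p (tmul a b) ≤ C * (‖a‖ * ‖b‖)) (d : ProjTensor E F) :
    p d ≤ C * ‖d‖ := by
  refine UniformSpace.Completion.induction_on d (isClosed_le hp (by fun_prop)) fun x => ?_
  rw [UniformSpace.Completion.norm_coe]
  refine le_mul_projNorm (N := fun x => p (AlgTensor.of E F x : AlgTensor E F)) ?_ ?_ hC h x
  · simp [UniformSpace.Completion.coe_zero]
  · intro x y
    simpa only [map_add, UniformSpace.Completion.coe_add] using map_add_le_add p _ _

/-- The algebraic part of `lift`. -/
def algLift (f : E →L[ℂ] F →L[ℂ] G) : AlgTensor E F →ₗ[ℂ] G :=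
  TensorProduct.lift f.toLinearMap₁₂ ∘ₗ (AlgTensor.of E F).symm.toLinearMap

theorem norm_algLift_apply_le (f : E →L[ℂ] F →L[ℂ] G) (x : AlgTensor E F) :
    ‖algLift f x‖ ≤ ‖f‖ * ‖x‖ := by
  refine le_mul_projNorm (N := fun x => ‖algLift f (AlgTensor.of E F x)‖) ?_ ?_ (norm_nonneg f)
    ?_ x
  · simp
  · intro x y
    simpa only [map_add] using norm_add_le _ _
  · intro a b
    simpa [algLift, mul_assoc] using f.le_opNorm₂ a b

/-- The bounded operator on `E ⊗̂ F` that a bounded bilinear map induces by the universal property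
of the projective tensor product. -/
def lift [CompleteSpace G] (f : E →L[ℂ] F →L[ℂ] G) : ProjTensor E F →L[ℂ] G :=
  (algLift f).extendOfNorm
    (UniformSpace.Completion.toComplL : AlgTensor E F →L[ℂ] ProjTensor E F).toLinearMap

@[simp]
theorem lift_tmul [CompleteSpace G] (f : E →L[ℂ] F →L[ℂ] G) (a : E) (b : F) :
    lift f (tmul a b) = f a b :=
  (LinearMap.extendOfNorm_eq UniformSpace.Completion.denseRange_coe
    ⟨‖f‖, fun x => by simpa using norm_algLift_apply_le f x⟩
    (AlgTensor.of E F (a ⊗ₜ[ℂ] b))).trans (by simp [algLift])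

variable {V W H : Type*} [NormedAddCommGroup V] [NormedSpace ℂ V] [NormedAddCommGroup W]
  [NormedSpace ℂ W] [NormedAddCommGroup H] [NormedSpace ℂ H] [CompleteSpace H]

/-- The operator `a ⊗ b ↦ u a ∘ v b` on `E ⊗̂ F`. -/
def liftComp (u : E →L[ℂ] W →L[ℂ] H) (v : F →L[ℂ] V →L[ℂ] W) : ProjTensor E F →L[ℂ] V →L[ℂ] H :=
  lift ((ContinuousLinearMap.compL ℂ V W H).bilinearComp u v)

@[simp]
theorem liftComp_tmul (u : E →L[ℂ] W →L[ℂ] H) (v : F →L[ℂ] V →L[ℂ] W) (a : E) (b : F) :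
    liftComp u v (tmul a b) = u a ∘L v b := by
  simp [liftComp]

theorem seminorm_liftComp_le {p : Seminorm ℂ (V →L[ℂ] H)} (hp : Continuous p) {C : ℝ} (hC : 0 ≤ C)
    (h : ∀ (S : W →L[ℂ] H) (T : V →L[ℂ] W), p (S ∘L T) ≤ C * (‖S‖ * ‖T‖))
    (u : E →L[ℂ] W →L[ℂ] H) (v : F →L[ℂ] V →L[ℂ] W) (d : ProjTensor E F) :
    p (liftComp u v d) ≤ C * (‖u‖ * ‖v‖) * ‖d‖ := by
  refine seminorm_le_mul_norm (p := p.comp (liftComp u v).toLinearMap)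
    (hp.comp (liftComp u v).continuous) (by positivity) (fun a b => ?_) d
  calc p (liftComp u v (tmul a b)) ≤ C * (‖u a‖ * ‖v b‖) := by
        simpa only [liftComp_tmul] using h (u a) (v b)
    _ ≤ C * ((‖u‖ * ‖a‖) * (‖v‖ * ‖b‖)) := by gcongr <;> exact ContinuousLinearMap.le_opNorm _ _
    _ = C * (‖u‖ * ‖v‖) * (‖a‖ * ‖b‖) := by ring

end ProjTensor

/-! ### Insertion of an element into a tensor -/

section Insertion

variable {A B : Type*} [NonUnitalNormedRing A] [NormedSpace ℂ A]
  [NormedRing B] [NormedAlgebra ℂ B] [CompleteSpace B]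

/-- The operator `a ⊗ b ↦ φ a * s * φ b` on `A ⊗̂ A`. -/
def insertion (φ : A →L[ℂ] B) (s : B) : ProjTensor A A →L[ℂ] B :=
  ProjTensor.lift
    ((ContinuousLinearMap.mul ℂ B).bilinearComp ((ContinuousLinearMap.mul ℂ B).flip s ∘L φ) φ)

@[simp]
theorem insertion_tmul (φ : A →L[ℂ] B) (s : B) (a b : A) :
    insertion φ s (ProjTensor.tmul a b) = φ a * s * φ b := by
  simp [insertion]

theorem insertion_sub (φ : A →L[ℂ] B) (s t : B) (d : ProjTensor A A) :
    insertion φ (s - t) d = insertion φ s d - insertion φ t d := by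
  induction d using ProjTensor.induction_on with
  | closed => exact isClosed_eq (by fun_prop) (by fun_prop)
  | tmul a b => simp [mul_sub, sub_mul]
  | add x y hx hy =>
    simp only [UniformSpace.Completion.coe_add, map_add, hx, hy]
    abel

variable [IsScalarTower ℂ A A] [SMulCommClass ℂ A A]

theorem leftAct_tmul (a b c : A) :
    leftAct a (ProjTensor.tmul b c) = ProjTensor.tmul (a * b) c := by
  simp [ProjTensor.tmul, leftAct_coe, algLeft_tmul]

theorem rightAct_tmul (a b c : A) :
    rightAct (ProjTensor.tmul b c) a = ProjTensor.tmul b (c * a) := by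
  simp [ProjTensor.tmul, rightAct_coe, algRight_tmul]

theorem productMap_tmul [CompleteSpace A] (a b : A) :
    productMap A (ProjTensor.tmul a b) = a * b := by
  simp [ProjTensor.tmul, productMap_coe, algProduct_tmul]

theorem continuous_productMap [CompleteSpace A] : Continuous (productMap A) :=
  UniformSpace.Completion.continuous_extension

theorem norm_productMap_le [CompleteSpace A] (d : ProjTensor A A) : ‖productMap A d‖ ≤ ‖d‖ := by
  refine UniformSpace.Completion.induction_on d
    (isClosed_le continuous_productMap.norm continuous_norm) fun x => ?_
  rw [productMap_coe, UniformSpace.Completion.norm_coe, ← one_mul ‖x‖]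
  exact norm_mul'_le x

theorem insertion_one [CompleteSpace A] {φ : A →L[ℂ] B} (hφ : ∀ a b, φ (a * b) = φ a * φ b)
    (d : ProjTensor A A) : insertion φ 1 d = φ (productMap A d) := by
  induction d using ProjTensor.induction_on with
  | closed => exact isClosed_eq (by fun_prop) (φ.continuous.comp continuous_productMap)
  | tmul a b => simp [productMap_tmul, hφ]
  | add x y hx hy =>
    simp only [productMap_coe] at hx hy ⊢
    simp only [UniformSpace.Completion.coe_add, map_add, hx, hy]

theorem insertion_leftAct {φ : A →L[ℂ] B} (hφ : ∀ a b, φ (a * b) = φ a * φ b) (s : B) (a : A)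
    (d : ProjTensor A A) : insertion φ s (leftAct a d) = φ a * insertion φ s d := by
  induction d using ProjTensor.induction_on with
  | closed =>
    exact isClosed_eq ((insertion φ s).continuous.comp UniformSpace.Completion.continuous_map)
      (by fun_prop)
  | tmul b c => simp [leftAct_tmul, hφ, mul_assoc]
  | add x y hx hy =>
    simp only [leftAct_coe] at hx hy ⊢
    simp only [UniformSpace.Completion.coe_add, map_add, mul_add, hx, hy]

theorem insertion_rightAct {φ : A →L[ℂ] B} (hφ : ∀ a b, φ (a * b) = φ a * φ b) (s : B) (a : A)
    (d : ProjTensor A A) : insertion φ s (rightAct d a) = insertion φ s d * φ a := by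
  induction d using ProjTensor.induction_on with
  | closed =>
    exact isClosed_eq ((insertion φ s).continuous.comp UniformSpace.Completion.continuous_map)
      (by fun_prop)
  | tmul b c => simp [rightAct_tmul, hφ, mul_assoc]
  | add x y hx hy =>
    simp only [rightAct_coe] at hx hy ⊢
    simp only [UniformSpace.Completion.coe_add, map_add, add_mul, hx, hy]

end Insertion

/-! ### Approximate diagonals -/

section ApproximateDiagonal

open Filter

variable {A : Type*} [NonUnitalNormedRing A] [NormedSpace ℂ A] [IsScalarTower ℂ A A]
  [SMulCommClass ℂ A A] [CompleteSpace A] {K : ℝ} {D D' : Filter (ProjTensor A A)}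

/-- The filter `D` on `A ⊗̂ A` is an approximate diagonal of bound `K`. In contrast to a net, a
filter can be replaced by any finer one, for instance by an ultrafilter. -/
structure IsApproxDiagonal (K : ℝ) (D : Filter (ProjTensor A A)) : Prop where
  norm_le : ∀ᶠ d in D, ‖d‖ ≤ K
  tendsto_productMap_mul : ∀ a : A, Tendsto (fun d => productMap A d * a) D (𝓝 a)
  tendsto_leftAct_sub_rightAct : ∀ a : A, Tendsto (fun d => leftAct a d - rightAct d a) D (𝓝 0)

theorem IsApproxDiagonal.mono (hD : IsApproxDiagonal K D) (h : D' ≤ D) : IsApproxDiagonal K D' where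
  norm_le := hD.norm_le.filter_mono h
  tendsto_productMap_mul a := (hD.tendsto_productMap_mul a).mono_left h
  tendsto_leftAct_sub_rightAct a := (hD.tendsto_leftAct_sub_rightAct a).mono_left h

theorem IsKAmenable.exists_isApproxDiagonal (hK : IsKAmenable A K) :
    ∃ D : Filter (ProjTensor A A), D.NeBot ∧ IsApproxDiagonal K D := by
  obtain ⟨ι, _, _, _, d, norm_le, product, commutator⟩ := hK
  exact ⟨map d atTop, inferInstance, eventually_map.2 (.of_forall norm_le), product, commutator⟩

theorem IsApproxDiagonal.one_le [Nontrivial A] [D.NeBot] (hD : IsApproxDiagonal K D) : 1 ≤ K := by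
  obtain ⟨a, ha⟩ := exists_ne (0 : A)
  have norm_le : ‖a‖ ≤ K * ‖a‖ := by
    refine le_of_tendsto (hD.tendsto_productMap_mul a).norm (hD.norm_le.mono fun d hd => ?_)
    calc ‖productMap A d * a‖ ≤ ‖productMap A d‖ * ‖a‖ := norm_mul_le _ _
      _ ≤ K * ‖a‖ := by gcongr; exact (norm_productMap_le d).trans hd
  exact (le_mul_iff_one_le_left (norm_pos_iff.2 ha)).1 norm_le

theorem IsApproxDiagonal.tendsto_commutator_insertion {B : Type*} [NormedRing B]
    [NormedAlgebra ℂ B] [CompleteSpace B] (hD : IsApproxDiagonal K D) {φ : A →L[ℂ] B}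
    (hφ : ∀ a b, φ (a * b) = φ a * φ b) (s : B) (a : A) :
    Tendsto (fun d => φ a * insertion φ s d - insertion φ s d * φ a) D (𝓝 0) := by
  simpa only [Function.comp_def, map_sub, map_zero, insertion_leftAct hφ, insertion_rightAct hφ]
    using ((insertion φ s).continuous.tendsto 0).comp (hD.tendsto_leftAct_sub_rightAct a)

end ApproximateDiagonal

/-! ### Finite-rank operators -/

section FiniteRank

open Filter

variable {E F G : Type u} [NormedAddCommGroup E] [NormedSpace ℂ E]
  [NormedAddCommGroup F] [NormedSpace ℂ F] [NormedAddCommGroup G] [NormedSpace ℂ G]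

theorem smulRight_mem_finiteRank (g : E →L[ℂ] ℂ) (x : F) : g.smulRight x ∈ finiteRank E F := by
  rw [mem_finiteRank]
  refine Submodule.finiteDimensional_of_le (S₂ := Submodule.span ℂ {x}) ?_
  rintro _ ⟨y, rfl⟩
  exact Submodule.smul_mem _ _ (Submodule.mem_span_singleton_self x)

theorem nontrivial_of_finiteRank_subset_range {A : Type*} [NormedAddCommGroup A]
    [NormedSpace ℂ A] [Nontrivial E] {φ : A →L[ℂ] E →L[ℂ] E}
    (hrange : ∀ T ∈ finiteRank E E, ∃ a, φ a = T) : Nontrivial A := by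
  obtain ⟨e, he⟩ := exists_ne (0 : E)
  obtain ⟨f, hfe⟩ := SeparatingDual.exists_eq_one (R := ℂ) he
  obtain ⟨a, ha⟩ := hrange (f.smulRight e) (smulRight_mem_finiteRank f e)
  refine ⟨a, 0, ?_⟩
  rintro rfl
  exact he (by simpa [hfe] using (DFunLike.congr_fun ha e).symm)

theorem exists_eq_sum_smulRight {T : E →L[ℂ] F} (hT : T ∈ finiteRank E F) :
    ∃ (n : ℕ) (g : Fin n → E →L[ℂ] ℂ) (x : Fin n → F), T = ∑ i, (g i).smulRight (x i) := by
  have : FiniteDimensional ℂ T.range := hT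
  let b := Module.finBasis ℂ T.range
  refine ⟨_, fun i => (b.coord i).toContinuousLinearMap ∘L T.rangeRestrict, fun i => b i, ?_⟩
  ext x
  simpa [-ContinuousLinearMap.coe_rangeRestrict, -Module.Basis.sum_repr] using
    congrArg Subtype.val (b.sum_repr (T.rangeRestrict x)).symm

theorem exists_finiteRank_comp_eq {T : E →L[ℂ] F} (hT : T ∈ finiteRank E F) :
    ∃ R ∈ finiteRank F F, R ∘L T = T := by
  have : FiniteDimensional ℂ (LinearMap.range (T : E →ₗ[ℂ] F)) := hT
  obtain ⟨q, hq⟩ := Submodule.ClosedComplemented.of_finiteDimensional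
    (LinearMap.range (T : E →ₗ[ℂ] F))
  refine ⟨Submodule.subtypeL _ ∘L q, ?_, ?_⟩
  · refine Submodule.finiteDimensional_of_le (S₂ := LinearMap.range (T : E →ₗ[ℂ] F)) ?_
    rintro _ ⟨x, rfl⟩
    exact (q x).2
  · ext x
    exact congrArg Subtype.val (hq (T.rangeRestrict x))

theorem exists_comp_finiteRank_eq {T : E →L[ℂ] F} (hT : T ∈ finiteRank E F) :
    ∃ R ∈ finiteRank E E, T ∘L R = T := by
  have : FiniteDimensional ℂ (LinearMap.range (T : E →ₗ[ℂ] F)) := hT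
  obtain ⟨S, hS⟩ := T.rangeRestrict.exists_rightInverse_of_surjective
    T.toLinearMap.range_rangeRestrict
  refine ⟨S ∘L T.rangeRestrict, ?_, ?_⟩
  · refine Submodule.finiteDimensional_of_le (S₂ := LinearMap.range S.toLinearMap) ?_
    rintro _ ⟨x, rfl⟩
    exact ⟨T.rangeRestrict x, rfl⟩
  · ext x
    exact congrArg Subtype.val (DFunLike.congr_fun hS (T.rangeRestrict x))

theorem tendsto_comp_of_tendsto_apply {ι : Type*} {D : Filter ι} {M : ι → F →L[ℂ] G}
    {N : F →L[ℂ] G} (h : ∀ y, Tendsto (fun i => M i y) D (𝓝 (N y))) {T : E →L[ℂ] F}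
    (hT : T ∈ finiteRank E F) : Tendsto (fun i => M i ∘L T) D (𝓝 (N ∘L T)) := by
  obtain ⟨n, g, x, rfl⟩ := exists_eq_sum_smulRight hT
  have comp_smulRight (L : F →L[ℂ] G) (i : Fin n) :
      L ∘L (g i).smulRight (x i) = ContinuousLinearMap.smulRightL ℂ E G (g i) (L (x i)) := by
    ext; simp
  simp only [ContinuousLinearMap.comp_finsetSum, comp_smulRight]
  exact tendsto_finsetSum _ fun i _ =>
    ((ContinuousLinearMap.smulRightL ℂ E G (g i)).continuous.tendsto _).comp (h (x i))

end FiniteRank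

/-! ### Asymptotically central operators -/

section AsymptoticallyCentral

open Filter

variable {E : Type u} [NormedAddCommGroup E] [NormedSpace ℂ E] {ι : Type*} {D : Filter ι}
  {M N : ι → E →L[ℂ] E} {b c : ℂ}

/-- The operators `M i` act in the limit on the finite-rank operators, from both sides, as the
scalar `c`. -/
structure TendstoScalar (M : ι → E →L[ℂ] E) (D : Filter ι) (c : ℂ) : Prop where
  mul_right : ∀ a ∈ finiteRank E E, Tendsto (fun i => M i * a) D (𝓝 (c • a))
  mul_left : ∀ a ∈ finiteRank E E, Tendsto (fun i => a * M i) D (𝓝 (c • a))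

theorem TendstoScalar.sub (hM : TendstoScalar M D b) (hN : TendstoScalar N D c) :
    TendstoScalar (fun i => M i - N i) D (b - c) where
  mul_right a ha := by
    simpa only [sub_mul, sub_smul] using (hM.mul_right a ha).sub (hN.mul_right a ha)
  mul_left a ha := by
    simpa only [mul_sub, sub_smul] using (hM.mul_left a ha).sub (hN.mul_left a ha)

theorem tendstoScalar_of_tendsto_commutator
    (hM : ∀ a ∈ finiteRank E E, Tendsto (fun i => a * M i - M i * a) D (𝓝 0))
    {f : E →L[ℂ] ℂ} {e : E} (hfe : f e = 1) (hc : Tendsto (fun i => f (M i e)) D (𝓝 c)) :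
    TendstoScalar M D c := by
  have pointwise (x : E) : Tendsto (fun i => M i x) D (𝓝 (c • x)) := by
    -- The commutator of `f.smulRight x` and `M i` maps `e` to `f (M i e) • x - M i x`.
    have commutator_apply := ((ContinuousLinearMap.apply ℂ E e).continuous.tendsto 0).comp
      (hM (f.smulRight x) (smulRight_mem_finiteRank f x))
    simpa [Function.comp_def, hfe] using (hc.smul_const x).sub commutator_apply
  have mul_right (a) (ha : a ∈ finiteRank E E) : Tendsto (fun i => M i * a) D (𝓝 (c • a)) := by
    simpa only [ContinuousLinearMap.mul_def, ContinuousLinearMap.smul_comp,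
      ContinuousLinearMap.id_comp] using
      tendsto_comp_of_tendsto_apply (N := c • .id ℂ E) pointwise ha
  exact ⟨mul_right, fun a ha => by simpa using (hM a ha).add (mul_right a ha)⟩

end AsymptoticallyCentral

/-! ### Insertion into an approximate diagonal of an algebra of operators -/

section OperatorAlgebra

open Filter

variable {A : Type*} {X : Type u} [NonUnitalNormedRing A] [NormedSpace ℂ A] [IsScalarTower ℂ A A]
  [SMulCommClass ℂ A A] [CompleteSpace A] [NormedAddCommGroup X] [NormedSpace ℂ X]
  [CompleteSpace X] {φ : A →L[ℂ] X →L[ℂ] X} {K : ℝ} {D : Filter (ProjTensor A A)}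

theorem IsApproxDiagonal.tendstoScalar_insertion (hD : IsApproxDiagonal K D)
    (hφ : ∀ a b, φ (a * b) = φ a * φ b) (hrange : ∀ T ∈ finiteRank X X, ∃ a, φ a = T)
    (s : X →L[ℂ] X) {f : X →L[ℂ] ℂ} {e : X} (hfe : f e = 1) {c : ℂ}
    (hc : Tendsto (fun d => f (insertion φ s d e)) D (𝓝 c)) :
    TendstoScalar (insertion φ s) D c := by
  refine tendstoScalar_of_tendsto_commutator (fun T hT => ?_) hfe hc
  obtain ⟨a, rfl⟩ := hrange T hT
  exact hD.tendsto_commutator_insertion hφ s a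

theorem IsApproxDiagonal.tendstoScalar_insertion_one [Nontrivial X] (hD : IsApproxDiagonal K D)
    (hφ : ∀ a b, φ (a * b) = φ a * φ b) (hrange : ∀ T ∈ finiteRank X X, ∃ a, φ a = T) :
    TendstoScalar (insertion φ 1) D 1 := by
  obtain ⟨e, he⟩ := exists_ne (0 : X)
  obtain ⟨f, hfe⟩ := SeparatingDual.exists_eq_one (R := ℂ) he
  refine hD.tendstoScalar_insertion hφ hrange 1 hfe ?_
  obtain ⟨a, ha⟩ := hrange (f.smulRight e) (smulRight_mem_finiteRank f e)
  have eval := ((f ∘L ContinuousLinearMap.apply ℂ X e ∘L φ).continuous.tendsto a).comp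
    (hD.tendsto_productMap_mul a)
  simpa [Function.comp_def, insertion_one hφ, hφ, ha, hfe] using eval

theorem IsApproxDiagonal.exists_tendstoScalar_insertion [Nontrivial X] [D.NeBot]
    (hD : IsApproxDiagonal K D) (hφ : ∀ a b, φ (a * b) = φ a * φ b)
    (hrange : ∀ T ∈ finiteRank X X, ∃ a, φ a = T) (s : X →L[ℂ] X) :
    ∃ D' ≤ D, D'.NeBot ∧ ∃ c : ℂ, TendstoScalar (insertion φ s) D' c ∧
      TendstoScalar (insertion φ (1 - s)) D' (1 - c) := by
  obtain ⟨e, he⟩ := exists_ne (0 : X)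
  obtain ⟨f, hfe⟩ := SeparatingDual.exists_eq_one (R := ℂ) he
  let g := f ∘L ContinuousLinearMap.apply ℂ X e ∘L insertion φ s
  let U := Ultrafilter.of D
  have hU := hD.mono (Ultrafilter.of_le D)
  have bounded : ∀ᶠ d in U, g d ∈ Metric.closedBall 0 (‖g‖ * K) :=
    hU.norm_le.mono fun d hd => mem_closedBall_zero_iff.2 (g.le_opNorm_of_le hd)
  obtain ⟨c, -, hc⟩ := (isCompact_closedBall _ _).ultrafilter_le_nhds (U.map g)
    (le_principal_iff.2 bounded)
  have tendsto_c := hU.tendstoScalar_insertion hφ hrange s hfe hc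
  refine ⟨U, Ultrafilter.of_le D, inferInstance, c, tendsto_c, ?_⟩
  simpa only [← insertion_sub] using (hU.tendstoScalar_insertion_one hφ hrange).sub tendsto_c

end OperatorAlgebra

/-! ### Ideal norms -/

section IdealNorm

open Filter

theorem seminorm_continuous_of_le_mul_norm {V : Type*} [SeminormedAddCommGroup V] [NormedSpace ℂ V]
    {p : Seminorm ℂ V} {C : ℝ} (h : ∀ x, p x ≤ C * ‖x‖) : Continuous p := by
  refine Seminorm.continuous_of_continuousAt_zero ?_
  rw [ContinuousAt, map_zero]
  exact squeeze_zero (apply_nonneg p) h (by simpa using tendsto_norm_zero.const_mul C)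

variable {E F G : Type u} [NormedAddCommGroup E] [NormedSpace ℂ E] [CompleteSpace E]
  [NormedAddCommGroup F] [NormedSpace ℂ F] [CompleteSpace F]
  [NormedAddCommGroup G] [NormedSpace ℂ G] [CompleteSpace G]

namespace OperatorIdealNorm

variable (γ τ : OperatorIdealNorm.{u}) {C : ℝ}

/-- The seminorm `S ↦ τ (S T)`. -/
def postcompSeminorm (T : finiteRank E F) : Seminorm ℂ (F →L[ℂ] G) :=
  Seminorm.of (fun S => τ.toFun (finiteRank.sandwich S T (.id ℂ E)))
    (fun S S' => τ.add_le (finiteRank.sandwich S T _) (finiteRank.sandwich S' T _))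
    (fun a S => τ.map_smul a (finiteRank.sandwich S T _))

/-- The seminorm `S ↦ τ (T S)`. -/
def precompSeminorm (T : finiteRank F G) : Seminorm ℂ (E →L[ℂ] F) :=
  Seminorm.of (fun S => τ.toFun (finiteRank.sandwich (.id ℂ G) T S))
    (fun S S' => by
      have : finiteRank.sandwich (.id ℂ G) T (S + S') =
          finiteRank.sandwich (.id ℂ G) T S + finiteRank.sandwich (.id ℂ G) T S' :=
        Subtype.ext (ContinuousLinearMap.comp_add _ S S')
      exact this ▸ τ.add_le _ _)
    (fun a S => by
      have : finiteRank.sandwich (.id ℂ G) T (a • S) =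
          a • finiteRank.sandwich (.id ℂ G) T S :=
        Subtype.ext (ContinuousLinearMap.comp_smul _ a S)
      exact this ▸ τ.map_smul _ _)

theorem postcompSeminorm_le (T : finiteRank E F) (S : F →L[ℂ] G) :
    τ.postcompSeminorm T S ≤ τ.toFun T * ‖S‖ := by
  calc τ.postcompSeminorm T S ≤ ‖S‖ * τ.toFun T * ‖ContinuousLinearMap.id ℂ E‖ := τ.ideal _ _ _
    _ ≤ ‖S‖ * τ.toFun T := mul_le_of_le_one_right (mul_nonneg (norm_nonneg _) (τ.nonneg T))
      ContinuousLinearMap.norm_id_le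
    _ = τ.toFun T * ‖S‖ := mul_comm _ _

theorem precompSeminorm_le (T : finiteRank F G) (S : E →L[ℂ] F) :
    τ.precompSeminorm T S ≤ τ.toFun T * ‖S‖ := by
  refine (τ.ideal _ T S).trans (mul_le_mul_of_nonneg_right ?_ (norm_nonneg S))
  exact mul_le_of_le_one_left (τ.nonneg T) ContinuousLinearMap.norm_id_le

theorem continuous_postcompSeminorm (T : finiteRank E F) :
    Continuous (τ.postcompSeminorm T : Seminorm ℂ (F →L[ℂ] G)) :=
  seminorm_continuous_of_le_mul_norm (τ.postcompSeminorm_le T)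

theorem continuous_precompSeminorm (T : finiteRank F G) :
    Continuous (τ.precompSeminorm T : Seminorm ℂ (E →L[ℂ] F)) :=
  seminorm_continuous_of_le_mul_norm (τ.precompSeminorm_le T)

variable {ι : Type*} {D : Filter ι} {M : ι → E →L[ℂ] E} {c : ℂ}

theorem tendsto_postcompSeminorm (hM : TendstoScalar M D c) (T : finiteRank F E) :
    Tendsto (fun i => τ.postcompSeminorm T (M i)) D (𝓝 (‖c‖ * τ.toFun T)) := by
  obtain ⟨R, hR, hRT⟩ := exists_finiteRank_comp_eq T.2
  have comp_eq (S : E →L[ℂ] E) : τ.postcompSeminorm T (S * R) = τ.postcompSeminorm T S :=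
    congrArg τ.toFun (Subtype.ext (congrArg (S ∘L ·) hRT))
  have limit := ((τ.continuous_postcompSeminorm T).tendsto _).comp (hM.mul_right R hR)
  have value : τ.postcompSeminorm T R = τ.toFun T := congrArg τ.toFun (Subtype.ext hRT)
  simpa only [Function.comp_def, comp_eq, map_smul_eq_mul, value] using limit

theorem tendsto_precompSeminorm (hM : TendstoScalar M D c) (T : finiteRank E F) :
    Tendsto (fun i => τ.precompSeminorm T (M i)) D (𝓝 (‖c‖ * τ.toFun T)) := by
  obtain ⟨R, hR, hTR⟩ := exists_comp_finiteRank_eq T.2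
  have comp_eq (S : E →L[ℂ] E) : τ.precompSeminorm T (R * S) = τ.precompSeminorm T S :=
    congrArg τ.toFun (Subtype.ext (congrArg (· ∘L S) hTR))
  have limit := ((τ.continuous_precompSeminorm T).tendsto _).comp (hM.mul_left R hR)
  have value : τ.precompSeminorm T R = τ.toFun T := congrArg τ.toFun (Subtype.ext hTR)
  simpa only [Function.comp_def, comp_eq, map_smul_eq_mul, value] using limit

variable {γ τ} {E₀ : Type u} [NormedAddCommGroup E₀] [NormedSpace ℂ E₀] [CompleteSpace E₀]

theorem postcompSeminorm_comp_le (hC : 0 ≤ C) (h : ∀ R : finiteRank E₀ F, τ.toFun R ≤ C * γ.toFun R)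
    (T : finiteRank E₀ E) (S : F →L[ℂ] G) (S' : E →L[ℂ] F) :
    τ.postcompSeminorm T (S ∘L S') ≤ C * γ.toFun T * (‖S‖ * ‖S'‖) := by
  let R := finiteRank.sandwich S' T (.id ℂ E₀)
  calc τ.postcompSeminorm T (S ∘L S') = τ.postcompSeminorm R S := rfl
    _ ≤ τ.toFun R * ‖S‖ := τ.postcompSeminorm_le R S
    _ ≤ C * (γ.toFun T * ‖S'‖) * ‖S‖ := by
      gcongr
      exact (h R).trans (mul_le_mul_of_nonneg_left (γ.postcompSeminorm_le T S') hC)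
    _ = C * γ.toFun T * (‖S‖ * ‖S'‖) := by ring

theorem precompSeminorm_comp_le (hC : 0 ≤ C) (h : ∀ R : finiteRank F E₀, τ.toFun R ≤ C * γ.toFun R)
    (T : finiteRank G E₀) (S : F →L[ℂ] G) (S' : E →L[ℂ] F) :
    τ.precompSeminorm T (S ∘L S') ≤ C * γ.toFun T * (‖S‖ * ‖S'‖) := by
  let R := finiteRank.sandwich (.id ℂ E₀) T S
  calc τ.precompSeminorm T (S ∘L S') = τ.precompSeminorm R S' := rfl
    _ ≤ τ.toFun R * ‖S'‖ := τ.precompSeminorm_le R S'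
    _ ≤ C * (γ.toFun T * ‖S‖) * ‖S'‖ := by
      gcongr
      exact (h R).trans (mul_le_mul_of_nonneg_left (γ.precompSeminorm_le T S) hC)
    _ = C * γ.toFun T * (‖S‖ * ‖S'‖) := by ring

open ProjTensor in
theorem norm_mul_toFun_le_of_tendstoScalar {A B : Type v} [NormedAddCommGroup A] [NormedSpace ℂ A]
    [NormedAddCommGroup B] [NormedSpace ℂ B] {D : Filter (ProjTensor A B)} [D.NeBot] {K : ℝ}
    (hD : ∀ᶠ d in D, ‖d‖ ≤ K) {u : A →L[ℂ] F →L[ℂ] E} {v : B →L[ℂ] E →L[ℂ] F}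
    (hM : TendstoScalar (liftComp u v) D c) (hC : 0 ≤ C)
    (h : (∀ R : finiteRank E F, τ.toFun R ≤ C * γ.toFun R) ∨
      ∀ R : finiteRank F E, τ.toFun R ≤ C * γ.toFun R) (T : finiteRank E E) :
    ‖c‖ * τ.toFun T ≤ C * γ.toFun T * (‖u‖ * ‖v‖) * K := by
  have hγ := γ.nonneg T
  rcases h with h | h
  · refine le_of_tendsto (τ.tendsto_postcompSeminorm hM T) (hD.mono fun d hd => ?_)
    refine (seminorm_liftComp_le (τ.continuous_postcompSeminorm T) (by positivity)
      (postcompSeminorm_comp_le hC h T) u v d).trans ?_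
    gcongr
  · refine le_of_tendsto (τ.tendsto_precompSeminorm hM T) (hD.mono fun d hd => ?_)
    refine (seminorm_liftComp_le (τ.continuous_precompSeminorm T) (by positivity)
      (precompSeminorm_comp_le hC h T) u v d).trans ?_
    gcongr

end OperatorIdealNorm

end IdealNorm

/-! ### Compression to complemented subspaces -/

section Compression

variable {X Y Z V : Type u} [NormedAddCommGroup X] [NormedSpace ℂ X] [NormedAddCommGroup Y]
  [NormedSpace ℂ Y] [NormedAddCommGroup Z] [NormedSpace ℂ Z] [NormedAddCommGroup V]
  [NormedSpace ℂ V]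

/-- The compression `a ↦ r ∘ a ∘ j` of operators on `X` to operators `Z → Y`. -/
def compress (r : X →L[ℂ] Y) (j : Z →L[ℂ] X) : (X →L[ℂ] X) →L[ℂ] Z →L[ℂ] Y :=
  ContinuousLinearMap.compL ℂ Z X Y r ∘L (ContinuousLinearMap.compL ℂ Z X X).flip j

@[simp]
theorem compress_apply (r : X →L[ℂ] Y) (j : Z →L[ℂ] X) (a : X →L[ℂ] X) :
    compress r j a = r ∘L a ∘L j := rfl

theorem norm_compress_le (r : X →L[ℂ] Y) (j : Z →L[ℂ] X) : ‖compress r j‖ ≤ ‖r‖ * ‖j‖ := by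
  refine ContinuousLinearMap.opNorm_le_bound _ (by positivity) fun a => ?_
  calc ‖r ∘L a ∘L j‖ ≤ ‖r‖ * (‖a‖ * ‖j‖) :=
        (r.opNorm_comp_le _).trans (by gcongr; exact a.opNorm_comp_le j)
    _ = ‖r‖ * ‖j‖ * ‖a‖ := by ring

theorem compress_mul_mul (r : X →L[ℂ] Y) (j : Z →L[ℂ] X) (t : X →L[ℂ] Z) (i : V →L[ℂ] X)
    (a b : X →L[ℂ] X) :
    compress r i (a * (j ∘L t) * b) = compress r j a ∘L compress t i b := rfl

theorem TendstoScalar.compress {i : Y →L[ℂ] X} {r : X →L[ℂ] Y} (hri : r ∘L i = .id ℂ Y)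
    {ι : Type*} {D : Filter ι} {M : ι → X →L[ℂ] X} {c : ℂ} (hM : TendstoScalar M D c) :
    TendstoScalar (fun k => compress r i (M k)) D c := by
  have hri' (y : Y) : r (i y) = y := DFunLike.congr_fun hri y
  have extend_mem {a : Y →L[ℂ] Y} (ha : a ∈ finiteRank Y Y) : i ∘L a ∘L r ∈ finiteRank X X :=
    comp_comp_mem_finiteRank i ha r
  have compress_smul_extend (a : Y →L[ℂ] Y) :
      OperatorIdeals.compress r i (c • (i ∘L a ∘L r)) = c • a := by
    ext; simp [hri']
  have continuous_compress := (OperatorIdeals.compress r i).continuous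
  constructor
  · intro a ha
    have limit := (continuous_compress.tendsto _).comp (hM.mul_right _ (extend_mem ha))
    rw [compress_smul_extend] at limit
    refine limit.congr fun k => ?_
    ext; simp [hri']
  · intro a ha
    have limit := (continuous_compress.tendsto _).comp (hM.mul_left _ (extend_mem ha))
    rw [compress_smul_extend] at limit
    refine limit.congr fun k => ?_
    ext; simp [hri']

variable [CompleteSpace X] [CompleteSpace Y] {A : Type*} [NonUnitalNormedRing A]
  [NormedSpace ℂ A]

theorem compress_insertion (φ : A →L[ℂ] X →L[ℂ] X) (r : X →L[ℂ] Y) (j : Z →L[ℂ] X)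
    (t : X →L[ℂ] Z) (i : V →L[ℂ] X) (d : ProjTensor A A) :
    compress r i (insertion φ (j ∘L t) d) =
      ProjTensor.liftComp (compress r j ∘L φ) (compress t i ∘L φ) d := by
  induction d using ProjTensor.induction_on with
  | closed => exact isClosed_eq (by fun_prop) (by fun_prop)
  | tmul a b => rw [insertion_tmul, compress_mul_mul, ProjTensor.liftComp_tmul]; rfl
  | add x y hx hy => simp only [UniformSpace.Completion.coe_add, map_add, hx, hy]

end Compression

/-! ### Transfer of equivalences of ideal norms -/

section Transfer

variable {Y Z : Type u} [NormedAddCommGroup Y] [NormedSpace ℂ Y] [CompleteSpace Y]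
  [NormedAddCommGroup Z] [NormedSpace ℂ Z] [CompleteSpace Z] {K M : ℝ}

/-- An equivalence of two ideal norms on `𝓕(Y, Z)` or on `𝓕(Z, Y)` implies their equivalence on
`𝓕(Y)`, with both constants worse by the factor `M`. -/
def NormBoundsTransfer (Y Z : Type u) [NormedAddCommGroup Y] [NormedSpace ℂ Y] [CompleteSpace Y]
    [NormedAddCommGroup Z] [NormedSpace ℂ Z] [CompleteSpace Z] (M : ℝ) : Prop :=
  ∀ (γ τ : OperatorIdealNorm.{u}) (c C : ℝ), 0 < c → 0 < C →
    NormBounds γ τ c C Y Z ∨ NormBounds γ τ c C Z Y → NormBounds γ τ (c * M⁻¹) (C * M) Y Y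

theorem normBoundsTransfer_of_forall_le (hM : 0 < M)
    (h : ∀ (γ τ : OperatorIdealNorm.{u}) (C : ℝ), 0 ≤ C →
      ((∀ R : finiteRank Y Z, τ.toFun R ≤ C * γ.toFun R) ∨
        ∀ R : finiteRank Z Y, τ.toFun R ≤ C * γ.toFun R) →
      ∀ T : finiteRank Y Y, τ.toFun T ≤ C * M * γ.toFun T) :
    NormBoundsTransfer Y Z M := by
  intro γ τ c C hc hC hbounds T
  have lower : γ.toFun T ≤ c⁻¹ * M * τ.toFun T :=
    h τ γ c⁻¹ (by positivity) (hbounds.imp (fun hR R => (le_inv_mul_iff₀ hc).2 (hR R).1)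
      fun hR R => (le_inv_mul_iff₀ hc).2 (hR R).1) T
  have upper := h γ τ C hC.le (hbounds.imp (fun hR R => (hR R).2) fun hR R => (hR R).2) T
  refine ⟨?_, upper⟩
  calc c * M⁻¹ * γ.toFun T ≤ c * M⁻¹ * (c⁻¹ * M * τ.toFun T) := by gcongr
    _ = τ.toFun T := by field_simp

variable {A : Type*} {X : Type u} [NonUnitalNormedRing A] [NormedSpace ℂ A] [NormedAddCommGroup X]
  [NormedSpace ℂ X] [CompleteSpace X] {φ : A →L[ℂ] X →L[ℂ] X}
  {i : Y →L[ℂ] X} {r : X →L[ℂ] Y} {j : Z →L[ℂ] X} {t : X →L[ℂ] Z}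

theorem normBoundsTransfer_of_tendstoScalar {D : Filter (ProjTensor A A)} [D.NeBot]
    (hD : ∀ᶠ d in D, ‖d‖ ≤ K) (hφ : ‖φ‖ ≤ 1) (hri : r ∘L i = .id ℂ Y) {c : ℂ}
    (hc : 1 / 2 ≤ ‖c‖) (h : TendstoScalar (insertion φ (j ∘L t)) D c) (hM : 0 < M)
    (hKM : 2 * K * (‖i‖ * ‖r‖ * (‖j‖ * ‖t‖)) ≤ M) : NormBoundsTransfer Y Z M := by
  refine normBoundsTransfer_of_forall_le hM fun γ τ C hC hle T => ?_
  have hK : 0 ≤ K := let ⟨d, hd⟩ := hD.exists; (norm_nonneg d).trans hd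
  have hγ := γ.nonneg T
  have hτ := τ.nonneg T
  have norm_left : ‖compress r j ∘L φ‖ ≤ ‖r‖ * ‖j‖ :=
    (ContinuousLinearMap.opNorm_comp_le _ _).trans
      ((mul_le_of_le_one_right (norm_nonneg _) hφ).trans (norm_compress_le r j))
  have norm_right : ‖compress t i ∘L φ‖ ≤ ‖t‖ * ‖i‖ :=
    (ContinuousLinearMap.opNorm_comp_le _ _).trans
      ((mul_le_of_le_one_right (norm_nonneg _) hφ).trans (norm_compress_le t i))
  have compressed := h.compress hri
  simp only [compress_insertion] at compressed
  have key := OperatorIdealNorm.norm_mul_toFun_le_of_tendstoScalar hD compressed hC hle T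
  calc τ.toFun T ≤ 2 * (‖c‖ * τ.toFun T) := by nlinarith
    _ ≤ 2 * (C * γ.toFun T * ((‖r‖ * ‖j‖) * (‖t‖ * ‖i‖)) * K) := by
      grw [key, norm_left, norm_right]
    _ = C * (2 * K * (‖i‖ * ‖r‖ * (‖j‖ * ‖t‖))) * γ.toFun T := by ring
    _ ≤ C * M * γ.toFun T := by gcongr

theorem IsApproxDiagonal.normBoundsTransfer_or [IsScalarTower ℂ A A] [SMulCommClass ℂ A A]
    [CompleteSpace A] [Nontrivial X] {D : Filter (ProjTensor A A)} [D.NeBot]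
    (hD : IsApproxDiagonal K D) (hφ : ∀ a b, φ (a * b) = φ a * φ b)
    (hφ_norm : ‖φ‖ ≤ 1) (hrange : ∀ T ∈ finiteRank X X, ∃ a, φ a = T)
    (hri : r ∘L i = .id ℂ Y) (htj : t ∘L j = .id ℂ Z) (hdecomp : j ∘L t = 1 - i ∘L r)
    (hM : 0 < M) (hKM : 2 * K * (‖i‖ * ‖r‖ * (‖j‖ * ‖t‖)) ≤ M) :
    NormBoundsTransfer Y Z M ∨ NormBoundsTransfer Z Y M := by
  obtain ⟨D', hle, _, c, tendsto_c, tendsto_one_sub_c⟩ :=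
    hD.exists_tendstoScalar_insertion hφ hrange (i ∘L r)
  have norm_le := (hD.mono hle).norm_le
  have half_le : 1 / 2 ≤ ‖1 - c‖ ∨ 1 / 2 ≤ ‖c‖ := by
    have : 1 ≤ ‖1 - c‖ + ‖c‖ := by simpa using norm_add_le (1 - c) c
    by_contra! small
    linarith [small.1, small.2]
  rw [← hdecomp] at tendsto_one_sub_c
  rcases half_le with hc | hc
  · exact .inl (normBoundsTransfer_of_tendstoScalar norm_le hφ_norm hri hc tendsto_one_sub_c
      hM hKM)
  · exact .inr (normBoundsTransfer_of_tendstoScalar norm_le hφ_norm htj hc tendsto_c hM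
      (by rwa [mul_comm (‖j‖ * ‖t‖)]))

end Transfer

/-! ### Ranges of projections -/

section Range

theorem one_le_norm_of_isIdempotentElem {R : Type*} [NonUnitalNormedRing R] {p : R}
    (hp : IsIdempotentElem p) (h0 : p ≠ 0) : 1 ≤ ‖p‖ := by
  have : ‖p‖ ≤ ‖p‖ * ‖p‖ := by simpa only [hp.eq] using norm_mul_le p p
  exact (le_mul_iff_one_le_left (norm_pos_iff.2 h0)).1 this

theorem sqrt_two_mul_le {K p q : ℝ} (hK : 1 ≤ K) (hp : 1 ≤ p) (hq : 1 ≤ q) :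
    √(2 * K * (p * q)) ≤ 4 * K ^ 2 * p * q * max (p ^ 4) (q ^ 4) := by
  have hpq : 1 ≤ p * q := one_le_mul_of_one_le_of_one_le hp hq
  have hKK : 2 * K ≤ 4 * K ^ 2 := by nlinarith
  calc √(2 * K * (p * q)) ≤ 2 * K * (p * q) := Real.sqrt_le_self_iff.2 (.inr (by nlinarith))
    _ ≤ 4 * K ^ 2 * (p * q) := by gcongr
    _ ≤ 4 * K ^ 2 * (p * q) * max (p ^ 4) (q ^ 4) :=
      le_mul_of_one_le_right (by positivity) (le_max_of_le_left (one_le_pow₀ hp))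
    _ = 4 * K ^ 2 * p * q * max (p ^ 4) (q ^ 4) := by ring

variable {X : Type u} [NormedAddCommGroup X] [NormedSpace ℂ X]

theorem rangeRestrict_comp_subtypeL {P : X →L[ℂ] X} (hP : IsIdempotentElem P) :
    P.rangeRestrict ∘L (rg P).subtypeL = .id ℂ (rg P) := by
  ext ⟨_, y, rfl⟩
  exact DFunLike.congr_fun hP.eq y

theorem norm_rangeRestrict_le (P : X →L[ℂ] X) : ‖P.rangeRestrict‖ ≤ ‖P‖ :=
  P.rangeRestrict.opNorm_le_bound (norm_nonneg P) P.le_opNorm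

theorem IsApproxDiagonal.normBoundsTransfer_rg_or [CompleteSpace X] {A : Type*}
    [NonUnitalNormedRing A] [NormedSpace ℂ A] [IsScalarTower ℂ A A] [SMulCommClass ℂ A A]
    [CompleteSpace A] [Nontrivial X] {D : Filter (ProjTensor A A)} [D.NeBot] {K : ℝ}
    (hD : IsApproxDiagonal K D) (hK : 0 < K) {φ : A →L[ℂ] X →L[ℂ] X}
    (hφ : ∀ a b, φ (a * b) = φ a * φ b) (hφ_norm : ‖φ‖ ≤ 1)
    (hrange : ∀ T ∈ finiteRank X X, ∃ a, φ a = T) {P : X →L[ℂ] X} (hP : IsIdempotentElem P)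
    (hP0 : P ≠ 0) (hP1 : P ≠ 1) [CompleteSpace (rg P)] [CompleteSpace (rg (1 - P))] :
    NormBoundsTransfer (rg P) (rg (1 - P)) (2 * K * (‖P‖ * ‖1 - P‖)) ∨
      NormBoundsTransfer (rg (1 - P)) (rg P) (2 * K * (‖P‖ * ‖1 - P‖)) := by
  have one_sub_ne_zero : 1 - P ≠ 0 := sub_ne_zero.2 hP1.symm
  refine hD.normBoundsTransfer_or hφ hφ_norm hrange (rangeRestrict_comp_subtypeL hP)
    (rangeRestrict_comp_subtypeL hP.one_sub) rfl (by positivity) ?_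
  have norm_retraction_le (Q : X →L[ℂ] X) : ‖(rg Q).subtypeL‖ * ‖Q.rangeRestrict‖ ≤ ‖Q‖ := by
    grw [(rg Q).norm_subtypeL_le, one_mul, norm_rangeRestrict_le]
  gcongr <;> exact norm_retraction_le _

/-- The isometric inclusion of `𝓐(X)` into the algebra of all bounded operators. -/
def approximable.inclusion (X : Type u) [NormedAddCommGroup X] [NormedSpace ℂ X] :
    approximable X →ₗᵢ[ℂ] X →L[ℂ] X where
  toFun a := a
  map_add' _ _ := rfl
  map_smul' _ _ := rfl
  norm_map' _ := rfl

theorem mem_approximable_of_mem_finiteRank {T : X →L[ℂ] X} (hT : T ∈ finiteRank X X) :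
    T ∈ approximable X :=
  NonUnitalSubalgebra.le_topologicalClosure (finiteRankAlgebra X) hT

end Range

end OperatorIdeals

end

open OperatorIdeals in
theorem mainTheorem9_general {A : Type*} {X : Type u} [NonUnitalNormedRing A] [NormedSpace ℂ A]
    [IsScalarTower ℂ A A] [SMulCommClass ℂ A A] [CompleteSpace A] [NormedAddCommGroup X]
    [NormedSpace ℂ X] [CompleteSpace X] (K : ℝ) (hK : IsKAmenable A K) (φ : A →L[ℂ] X →L[ℂ] X)
    (hφ : ∀ a b, φ (a * b) = φ a * φ b) (hφ_norm : ‖φ‖ ≤ 1)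
    (hrange : ∀ T ∈ finiteRank X X, ∃ a, φ a = T)
    (P : X →L[ℂ] X) (hP : IsIdempotentElem P) (hP0 : P ≠ 0) (hP1 : P ≠ 1) :
    haveI : CompleteSpace (rg P) := completeSpace_range hP
    haveI : CompleteSpace (rg (1 - P)) := completeSpace_range hP.one_sub
    ∃ κ : ℝ, 0 < κ ∧
      κ ≤ 4 * K ^ 2 * ‖P‖ * ‖1 - P‖ * max (‖P‖ ^ 4) (‖1 - P‖ ^ 4) ∧
      ∀ (γ τ : OperatorIdealNorm.{u}) (c C : ℝ), 0 < c → 0 < C →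
        (NormBounds γ τ c C (rg P) (rg (1 - P)) ∨ NormBounds γ τ c C (rg (1 - P)) (rg P)) →
        (NormBounds γ τ (c * κ ^ (-2 : ℤ)) (C * κ ^ 2) (rg P) (rg P) ∨
          NormBounds γ τ (c * κ ^ (-2 : ℤ)) (C * κ ^ 2) (rg (1 - P)) (rg (1 - P))) := by
  have : CompleteSpace (rg P) := completeSpace_range hP
  have : CompleteSpace (rg (1 - P)) := completeSpace_range hP.one_sub
  obtain ⟨x, hx⟩ := DFunLike.ne_iff.1 hP0
  have : Nontrivial X := nontrivial_of_ne (P x) 0 hx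
  have : Nontrivial A := nontrivial_of_finiteRank_subset_range hrange
  obtain ⟨D, _, hD⟩ := hK.exists_isApproxDiagonal
  have one_le_K := hD.one_le
  have one_le_norm := one_le_norm_of_isIdempotentElem hP hP0
  have one_le_norm_one_sub :=
    one_le_norm_of_isIdempotentElem hP.one_sub (sub_ne_zero.2 hP1.symm)
  have transfer :=
    hD.normBoundsTransfer_rg_or (by positivity) hφ hφ_norm hrange hP hP0 hP1
  set M := 2 * K * (‖P‖ * ‖1 - P‖)
  have hM : 0 < M := by positivity
  have sq_sqrt : √M ^ 2 = M := Real.sq_sqrt hM.le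
  have zpow_sqrt : √M ^ (-2 : ℤ) = M⁻¹ := by rw [zpow_neg, zpow_ofNat, sq_sqrt]
  refine ⟨√M, Real.sqrt_pos.2 hM, sqrt_two_mul_le one_le_K one_le_norm one_le_norm_one_sub,
    fun γ τ c C hc hC bounds => ?_⟩
  rw [zpow_sqrt, sq_sqrt]
  exact transfer.imp (fun h => h γ τ c C hc hC bounds) fun h => h γ τ c C hc hC bounds.symm

theorem mainTheorem9 {X : Type u} [NormedAddCommGroup X] [NormedSpace ℂ X] [CompleteSpace X]
    (K : ℝ) (hK : OperatorIdeals.IsKAmenable (OperatorIdeals.approximable X) K)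
    (P : X →L[ℂ] X) (hP : IsIdempotentElem P) (hP0 : P ≠ 0) (hP1 : P ≠ 1) :
    haveI : CompleteSpace (OperatorIdeals.rg P) := OperatorIdeals.completeSpace_range hP
    haveI : CompleteSpace (OperatorIdeals.rg (1 - P)) :=
      OperatorIdeals.completeSpace_range hP.one_sub
    ∃ κ : ℝ, 0 < κ ∧
      κ ≤ 4 * K ^ 2 * ‖P‖ * ‖1 - P‖ * max (‖P‖ ^ 4) (‖1 - P‖ ^ 4) ∧
      ∀ (γ τ : OperatorIdeals.OperatorIdealNorm.{u}) (c C : ℝ), 0 < c → 0 < C →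
        (OperatorIdeals.NormBounds γ τ c C (OperatorIdeals.rg P) (OperatorIdeals.rg (1 - P)) ∨
          OperatorIdeals.NormBounds γ τ c C
            (OperatorIdeals.rg (1 - P)) (OperatorIdeals.rg P)) →
        (OperatorIdeals.NormBounds γ τ (c * κ ^ (-2 : ℤ)) (C * κ ^ 2)
            (OperatorIdeals.rg P) (OperatorIdeals.rg P) ∨
          OperatorIdeals.NormBounds γ τ (c * κ ^ (-2 : ℤ)) (C * κ ^ 2)
            (OperatorIdeals.rg (1 - P)) (OperatorIdeals.rg (1 - P))) := by
  open OperatorIdeals in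
  exact mainTheorem9_general (A := approximable X) K hK
    (approximable.inclusion X).toContinuousLinearMap (fun _ _ => rfl)
    (LinearIsometry.norm_toContinuousLinearMap_le _)
    (fun T hT => ⟨⟨T, mem_approximable_of_mem_finiteRank hT⟩, rfl⟩) P hP hP0 hP1
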